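/- Let $X$ be a smooth connected curve over $\mathbb{C}$ (projective or affine), that is, a connected separated scheme of finite type over $\mathbb{C}$, smooth of relative dimension $1$. Let $\mathfrak{E}=(E,\phi)$ be a rank $2$ Higgs bundle on $X$: a locally free sheaf $E$ of rank $2$ with an $\mathcal{O}_X$-linear morphism $\phi\colon E\to E\otimes\Omega^1_X$ (the condition $\phi\wedge\phi=0$ is automatic on a curve). Let $\pi\colon\mathbb{P}E=\mathrm{Gr}_1(E)\to X$ be the Grassmann bundle of rank one locally free quotients of $E$, with its universal exact sequence $$0\to S\xrightarrow{\ a\ }\pi^*E\xrightarrow{\ q\ }Q\to 0,$$ let $\pi^*\phi\colon\pi^*E\to\pi^*E\otimes\Omega^1_{\mathbb{P}E}$ be the pulled back Higgs field (composed with $\pi^*\Omega^1_X\to\Omega^1_{\mathbb{P}E}$), and let $b=q\otimes\mathrm{id}\colon\pi^*E\otimes\Omega^1_{\mathbb{P}E}\to Q\otimes\Omega^1_{\mathbb{P}E}$. The Higgs Grassmannian $\mathrm{Gr}_1(\mathfrak{E})$ of rank one Higgs quotients of $\mathfrak{E}$ is the closed subscheme of $\mathbb{P}E$ defined by the zero locus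 of the composition $b\circ\pi^*\phi\circ a\colon S\to Q\otimes\Omega^1_{\mathbb{P}E}$. Then $\mathrm{Gr}_1(\mathfrak{E})$ is not empty. -/

import Mathlib

open CategoryTheory AlgebraicGeometry Limits

noncomputable section

universe u

namespace HiggsGr

/-! ### Sheafification, tensor products and Kähler differentials -/

/-- The sheaf of `𝒪_X`-modules associated with a presheaf of `𝒪_X`-modules. -/
def sheafify (X : Scheme.{u}) : X.PresheafOfModules ⥤ X.Modules :=
  PresheafOfModules.sheafification (𝟙 X.ringCatSheaf.obj)

/-- Sheafification is left adjoint to the inclusion of sheaves into presheaves. -/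
def sheafifyAdj (X : Scheme.{u}) : sheafify X ⊣ Scheme.Modules.toPresheafOfModules X :=
  PresheafOfModules.sheafificationAdjunction (𝟙 X.ringCatSheaf.obj)

/-- The tensor product `M ⊗ N` of `𝒪_X`-modules: the sheaf associated with
`U ↦ Γ(M, U) ⊗ Γ(N, U)`. -/
def tensor {X : Scheme.{u}} (M N : X.Modules) : X.Modules :=
  (sheafify X).obj (PresheafOfModules.Monoidal.tensorObj (R := X.presheaf) M.val N.val)

/-- The morphism `f ⊗ g`. -/
def tensorMap {X : Scheme.{u}} {M M' N N' : X.Modules} (f : M ⟶ M') (g : N ⟶ N') :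
    tensor M N ⟶ tensor M' N' :=
  (sheafify X).map (PresheafOfModules.Monoidal.tensorHom (R := X.presheaf) f.val g.val)

/-- For a scheme `X` over `k`, the structure maps `k ⟶ Γ(X, U)`, as a morphism from the constant
presheaf `k` to `𝒪_X`. -/
def constToPresheaf {X : Scheme.{u}} {k : CommRingCat.{u}} (p : X ⟶ Spec k) :
    (Functor.const X.Opensᵒᵖ).obj k ⟶ X.presheaf where
  app U := (Scheme.ΓSpecIso k).inv ≫ p.appTop ≫ X.presheaf.map (homOfLE le_top).op
  naturality U V i := by
    simp [← Functor.map_comp]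
    rfl

/-- The presheaf of Kähler differentials `U ↦ Ω¹_{Γ(X, U) / k}`. -/
def cotangentPresheaf {X : Scheme.{u}} {k : CommRingCat.{u}} (p : X ⟶ Spec k) :
    X.PresheafOfModules :=
  PresheafOfModules.DifferentialsConstruction.relativeDifferentials' (constToPresheaf p)

/-- The cotangent sheaf `Ω¹_{X/k}`: the sheaf associated with `U ↦ Ω¹_{Γ(X, U) / k}`. -/
def cotangent {X : Scheme.{u}} {k : CommRingCat.{u}} (p : X ⟶ Spec k) : X.Modules :=
  (sheafify X).obj (cotangentPresheaf p)

/-! ### Sections `d a` and `m ⊗ n` -/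

/-- The canonical map from `Ω¹_{Γ(X, U) / k}` to the sections of the cotangent sheaf. -/
def cotangentUnit {X : Scheme.{u}} {k : CommRingCat.{u}} (p : X ⟶ Spec k) (U : X.Opens) :
    CommRingCat.KaehlerDifferential ((constToPresheaf p).app (.op U)) →ₗ[Γ(X, U)]
      Γ(cotangent p, U) :=
  (((sheafifyAdj X).unit.app (cotangentPresheaf p)).app (.op U)).hom

/-- The section `d a` of the cotangent sheaf. -/
def dSec {X : Scheme.{u}} {k : CommRingCat.{u}} (p : X ⟶ Spec k) (U : X.Opens) (a : Γ(X, U)) :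
    Γ(cotangent p, U) :=
  cotangentUnit p U (CommRingCat.KaehlerDifferential.d a)

/-- The canonical map from the tensor product of sections to the sections of the tensor
product. -/
def tensorUnit {X : Scheme.{u}} (M N : X.Modules) (U : X.Opens) :
    TensorProduct Γ(X, U) Γ(M, U) Γ(N, U) →ₗ[Γ(X, U)] Γ(tensor M N, U) :=
  (((sheafifyAdj X).unit.app
    (PresheafOfModules.Monoidal.tensorObj (R := X.presheaf) M.val N.val)).app (.op U)).hom

/-- The section `m ⊗ n` of the tensor product. -/
def tmul {X : Scheme.{u}} {M N : X.Modules} {U : X.Opens} (m : Γ(M, U)) (n : Γ(N, U)) :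
    Γ(tensor M N, U) :=
  tensorUnit M N U (TensorProduct.tmul Γ(X, U) m n)

section

variable {X Y : Scheme.{u}} {k : CommRingCat.{u}} (p : X ⟶ Spec k) {U V : X.Opens}
  {M N : X.Modules}

lemma dSec_add (a b : Γ(X, U)) : dSec p U (a + b) = dSec p U a + dSec p U b :=
  (congrArg (cotangentUnit p U)
    ((CommRingCat.KaehlerDifferential.D ((constToPresheaf p).app (.op U))).d_add a b)).trans
    (map_add _ _ _)

lemma dSec_mul (a b : Γ(X, U)) : dSec p U (a * b) = a • dSec p U b + b • dSec p U a :=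
  (congrArg (cotangentUnit p U)
    ((CommRingCat.KaehlerDifferential.D ((constToPresheaf p).app (.op U))).d_mul a b)).trans
    ((map_add _ _ _).trans (congrArg₂ (· + ·) (map_smul _ a _) (map_smul _ b _)))

lemma dSec_const (c : k) : dSec p U ((constToPresheaf p).app (.op U) c) = 0 :=
  (congrArg (cotangentUnit p U)
    ((CommRingCat.KaehlerDifferential.D ((constToPresheaf p).app (.op U))).d_map c)).trans
    (map_zero _)

lemma dSec_res (i : U ⟶ V) (a : Γ(X, V)) :
    dSec p U (X.presheaf.map i.op a) = (cotangent p).presheaf.map i.op (dSec p V a) :=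
  (congrArg (cotangentUnit p U)
    (PresheafOfModules.DifferentialsConstruction.relativeDifferentials'_map_d
      (constToPresheaf p) i.op a).symm).trans
    (PresheafOfModules.naturality_apply ((sheafifyAdj X).unit.app (cotangentPresheaf p)) i.op
      (CommRingCat.KaehlerDifferential.d (f := (constToPresheaf p).app (.op V)) a))

lemma tmul_add (m : Γ(M, U)) (n n' : Γ(N, U)) : tmul m (n + n') = tmul m n + tmul m n' :=
  (congrArg (tensorUnit M N U) (TensorProduct.tmul_add m n n')).trans (map_add _ _ _)

lemma add_tmul (m m' : Γ(M, U)) (n : Γ(N, U)) : tmul (m + m') n = tmul m n + tmul m' n :=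
  (congrArg (tensorUnit M N U) (TensorProduct.add_tmul m m' n)).trans (map_add _ _ _)

lemma smul_tmul (a : Γ(X, U)) (m : Γ(M, U)) (n : Γ(N, U)) : tmul (a • m) n = a • tmul m n :=
  (congrArg (tensorUnit M N U) (TensorProduct.smul_tmul' a m n).symm).trans (map_smul _ _ _)

lemma tmul_smul (a : Γ(X, U)) (m : Γ(M, U)) (n : Γ(N, U)) : tmul m (a • n) = a • tmul m n :=
  (congrArg (tensorUnit M N U) (TensorProduct.tmul_smul a m n)).trans (map_smul _ _ _)

lemma tmul_res (i : U ⟶ V) (m : Γ(M, V)) (n : Γ(N, V)) :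
    tmul (M.presheaf.map i.op m) (N.presheaf.map i.op n) =
      (tensor M N).presheaf.map i.op (tmul m n) :=
  PresheafOfModules.naturality_apply ((sheafifyAdj X).unit.app
    (PresheafOfModules.Monoidal.tensorObj (R := X.presheaf) M.val N.val)) i.op
    (TensorProduct.tmul Γ(X, V) m n)

lemma constToPresheaf_app (f : Y ⟶ X) (p : X ⟶ Spec k) (U : X.Opens) (c : k) :
    f.app U ((constToPresheaf p).app (.op U) c) =
      (constToPresheaf (f ≫ p)).app (.op (f ⁻¹ᵁ U)) c :=
  congr($(f.naturality (homOfLE (le_top : U ≤ ⊤)).op) (p.appTop ((Scheme.ΓSpecIso k).inv c)))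

end

/-- The morphism `M ⊗ N ⟶ K` given by bilinear maps `β U : Γ(M, U) × Γ(N, U) → Γ(K, U)` compatible
with restriction; it sends `m ⊗ n` to `β m n`. -/
def tensorLift {X : Scheme.{u}} {M N K : X.Modules}
    (β : ∀ U : X.Opens, Γ(M, U) → Γ(N, U) → Γ(K, U))
    (add_left : ∀ U m m' n, β U (m + m') n = β U m n + β U m' n)
    (smul_left : ∀ U (a : Γ(X, U)) m n, β U (a • m) n = a • β U m n)
    (add_right : ∀ U m n n', β U m (n + n') = β U m n + β U m n')
    (smul_right : ∀ U (a : Γ(X, U)) m n, β U m (a • n) = a • β U m n)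
    (res : ∀ (U V : X.Opens) (i : U ⟶ V) m n,
      β U (M.presheaf.map i.op m) (N.presheaf.map i.op n) = K.presheaf.map i.op (β V m n)) :
    tensor M N ⟶ K :=
  ((sheafifyAdj X).homEquiv _ K).symm
    { app U := ModuleCat.MonoidalCategory.tensorLift (R := Γ(X, U.unop))
        (M₁ := M.val.obj U) (M₂ := N.val.obj U) (M₃ := K.val.obj U) (β U.unop)
        (add_left U.unop) (smul_left U.unop) (add_right U.unop) (smul_right U.unop)
      naturality {U _} i := ModuleCat.MonoidalCategory.tensor_ext (R := Γ(X, U.unop))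
        (M₁ := M.val.obj U) (M₂ := N.val.obj U) (fun m n ↦ res _ _ i.unop m n) }

/-- The morphism `Ω¹_{X/k} ⟶ K` given by a `k`-derivation `δ` of `𝒪_X` with values in `K`; it sends
`d a` to `δ a`. -/
def cotangentDesc {X : Scheme.{u}} {k : CommRingCat.{u}} (p : X ⟶ Spec k) {K : X.Modules}
    (δ : ∀ U : X.Opens, Γ(X, U) → Γ(K, U))
    (add : ∀ U a b, δ U (a + b) = δ U a + δ U b)
    (mul : ∀ U (a b : Γ(X, U)), δ U (a * b) = a • δ U b + b • δ U a)
    (const : ∀ U (c : k), δ U ((constToPresheaf p).app (.op U) c) = 0)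
    (res : ∀ (U V : X.Opens) (i : U ⟶ V) a,
      δ U (X.presheaf.map i.op a) = K.presheaf.map i.op (δ V a)) :
    cotangent p ⟶ K :=
  ((sheafifyAdj X).homEquiv _ K).symm
    ((PresheafOfModules.DifferentialsConstruction.isUniversal' (constToPresheaf p)).desc
      (M' := K.val)
      { d {U} := AddMonoidHom.mk' (δ U.unop) (add U.unop)
        d_mul {U} a b := mul U.unop a b
        d_map i a := res _ _ i.unop a
        d_app {U} c := const U.unop c })

/-- Pullback of differential forms along `f : Y ⟶ X`, as a morphism
`Ω¹_{X/k} ⟶ f_* Ω¹_{Y/k}`, `d a ↦ d (f^* a)`. -/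
def cotangentMap {X Y : Scheme.{u}} {k : CommRingCat.{u}} (f : Y ⟶ X) (p : X ⟶ Spec k) :
    cotangent p ⟶ (Scheme.Modules.pushforward f).obj (cotangent (f ≫ p)) :=
  cotangentDesc p (fun U a ↦ dSec (f ≫ p) (f ⁻¹ᵁ U) (f.app U a))
    (fun U a b ↦ (congrArg (dSec (f ≫ p) (f ⁻¹ᵁ U)) (map_add (f.app U).hom a b)).trans
      (dSec_add _ _ _))
    (fun U a b ↦ (congrArg (dSec (f ≫ p) (f ⁻¹ᵁ U)) (map_mul (f.app U).hom a b)).trans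
      (dSec_mul _ _ _))
    (fun U c ↦ (congrArg (dSec (f ≫ p) (f ⁻¹ᵁ U)) (constToPresheaf_app f p U c)).trans
      (dSec_const _ _))
    (fun U V i a ↦ (congrArg (dSec (f ≫ p) (f ⁻¹ᵁ U)) congr($(f.naturality i.op) a)).trans
      (dSec_res (f ≫ p) ((TopologicalSpace.Opens.map f.base).map i) (f.app V a)))

/-- Given `a : M ⟶ f_* M'` and `b : N ⟶ f_* N'`, the morphism `M ⊗ N ⟶ f_* (M' ⊗ N')`,
`m ⊗ n ↦ a m ⊗ b n`. -/
def tensorPush {X Y : Scheme.{u}} (f : Y ⟶ X) {M N : X.Modules} {M' N' : Y.Modules}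
    (a : M ⟶ (Scheme.Modules.pushforward f).obj M')
    (b : N ⟶ (Scheme.Modules.pushforward f).obj N') :
    tensor M N ⟶ (Scheme.Modules.pushforward f).obj (tensor M' N') :=
  tensorLift (fun U m n ↦ tmul (U := f ⁻¹ᵁ U) (a.app U m) (b.app U n))
    (fun U m m' n ↦ by rw [map_add]; exact add_tmul _ _ _)
    (fun U r m n ↦ by rw [Scheme.Modules.Hom.app_smul]; exact smul_tmul _ _ _)
    (fun U m n n' ↦ by rw [map_add]; exact tmul_add _ _ _)
    (fun U r m n ↦ by rw [Scheme.Modules.Hom.app_smul]; exact tmul_smul _ _ _)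
    (fun U V i m n ↦ by
      have h1 := congr($(a.mapPresheaf.naturality i.op) m)
      have h2 := congr($(b.mapPresheaf.naturality i.op) n)
      refine Eq.trans (congrArg₂ tmul h1 h2) ?_
      exact tmul_res _ _ _)

/-! ### Vector bundles, Higgs bundles, Grassmann bundles -/

/-- The `𝒪_X`-module `M` is locally free of rank `r`. -/
def IsLocallyFreeOfRank {X : Scheme.{u}} (M : X.Modules) (r : ℕ) : Prop :=
  ∀ x : X, ∃ U : X.Opens, x ∈ U ∧
    Nonempty (M.restrict U.ι ≅
      SheafOfModules.free (R := (U : Scheme.{u}).ringCatSheaf) (ULift.{u} (Fin r)))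

/-- A rank `r` Higgs bundle `(E, φ)` on a smooth curve `p : X ⟶ Spec k`: a locally free sheaf `E` of
rank `r` with an `𝒪_X`-linear morphism `φ : E ⟶ E ⊗ Ω¹_X`. (The integrability condition
`φ ∧ φ = 0`, which takes place in `E ⊗ Ω²_X`, is void on a curve, as `Ω²_X = 0` there.) -/
structure HiggsBundleOnCurve {X : Scheme.{u}} {k : CommRingCat.{u}} (p : X ⟶ Spec k) (r : ℕ) where
  /-- the underlying vector bundle -/
  E : X.Modules
  locallyFree : IsLocallyFreeOfRank E r
  /-- the Higgs field -/
  φ : E ⟶ tensor E (cotangent p)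

/-- The Grassmann bundle `π : Gr_d(E) ⟶ X` of rank `d` locally free quotients of `E`, with its
universal quotient `q : π^* E ⟶ Q`. It is determined up to unique isomorphism by its defining
universal property: for each `f : T ⟶ X`, every rank `d` locally free quotient `f^* E ⟶ R` is, up to
isomorphism of quotients, the pullback of `q` along a unique morphism `g : T ⟶ Gr_d(E)` over `X`. -/
structure GrassmannBundle {X : Scheme.{u}} (E : X.Modules) (d : ℕ) where
  /-- the total space -/
  P : Scheme.{u}
  /-- the projection -/
  π : P ⟶ X
  /-- the universal quotient bundle -/
  Q : P.Modules
  /-- the universal quotient morphism -/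
  q : (Scheme.Modules.pullback π).obj E ⟶ Q
  epi_q : Epi q
  locallyFree_Q : IsLocallyFreeOfRank Q d
  existsUnique_hom : ∀ (T : Scheme.{u}) (f : T ⟶ X) (R : T.Modules)
    (r : (Scheme.Modules.pullback f).obj E ⟶ R), Epi r → IsLocallyFreeOfRank R d →
    ∃! g : T ⟶ P, ∃ (h : g ≫ π = f) (e : (Scheme.Modules.pullback g).obj Q ≅ R),
      (Scheme.Modules.pullback g).map q ≫ e.hom =
        (Scheme.Modules.pullbackComp g π).hom.app E ≫
          (Scheme.Modules.pullbackCongr h).hom.app E ≫ r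

/-! ### The Higgs Grassmannian -/

/-- For a Higgs field `φ : E ⟶ E ⊗ Ω¹_X` and `f : Y ⟶ X`, the Higgs field
`f^* E ⟶ f^* E ⊗ f^* Ω¹_X ⟶ f^* E ⊗ Ω¹_Y`, written as the adjoint of
`E ⟶ E ⊗ Ω¹_X ⟶ f_* (f^* E ⊗ Ω¹_Y)`, where the second map is `e ⊗ ω ↦ f^* e ⊗ f^* ω`. -/
def pullbackHiggsField {X Y : Scheme.{u}} {k : CommRingCat.{u}} (f : Y ⟶ X) (p : X ⟶ Spec k)
    {E : X.Modules} (φ : E ⟶ tensor E (cotangent p)) :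
    (Scheme.Modules.pullback f).obj E ⟶
      tensor ((Scheme.Modules.pullback f).obj E) (cotangent (f ≫ p)) :=
  ((Scheme.Modules.pullbackPushforwardAdjunction f).homEquiv _ _).symm
    (φ ≫ tensorPush f ((Scheme.Modules.pullbackPushforwardAdjunction f).unit.app E)
      (cotangentMap f p))

/-- The composition `S_d ⟶ π^* E ⟶ π^* E ⊗ Ω¹ ⟶ Q_d ⊗ Ω¹` on the Grassmann bundle `Gr_d(E)`, where
`S_d` is the kernel of `q : π^* E ⟶ Q_d`, the middle map is `π^* φ` and `Ω¹` is the cotangent sheaf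
of `Gr_d(E)` over `k`. -/
def higgsComposition {X : Scheme.{u}} {k : CommRingCat.{u}} (p : X ⟶ Spec k) {r d : ℕ}
    (F : HiggsBundleOnCurve p r) (G : GrassmannBundle F.E d) :
    kernel G.q ⟶ tensor G.Q (cotangent (G.π ≫ p)) :=
  kernel.ι G.q ≫ pullbackHiggsField G.π p F.φ ≫ tensorMap G.q (𝟙 _)

/-- The ideal sheaf of the zero locus of a morphism `u : M ⟶ N`, for `N` locally free of finite rank:
the smallest ideal sheaf such that `u` vanishes on the closed subscheme that it defines. -/
def zeroLocusIdeal {Y : Scheme.{u}} {M N : Y.Modules} (u : M ⟶ N) : Y.IdealSheafData :=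
  sInf {I | (Scheme.Modules.pullback I.subschemeι).map u = 0}

/-- The `d`-th Higgs Grassmannian `Gr_d(𝔈)` of a Higgs bundle `𝔈 = (E, φ)`: the closed subscheme of
`Gr_d(E)` defined by the zero locus of the composition
`S_d ⟶ π^* E ⟶ π^* E ⊗ Ω¹ ⟶ Q_d ⊗ Ω¹`. -/
def higgsGrassmannian {X : Scheme.{u}} {k : CommRingCat.{u}} (p : X ⟶ Spec k) {r d : ℕ}
    (F : HiggsBundleOnCurve p r) (G : GrassmannBundle F.E d) : Scheme.{u} :=
  (zeroLocusIdeal (higgsComposition p F G)).subscheme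

end HiggsGr

end

noncomputable section

universe u

namespace HiggsGr

section Sections

variable {X Y Z : Scheme.{u}}

lemma app_res {M N : X.Modules} (α : M ⟶ N) {U V : X.Opens} (i : U ⟶ V) (s : Γ(M, V)) :
    α.app U (M.presheaf.map i.op s) = N.presheaf.map i.op (α.app V s) :=
  congr($(α.mapPresheaf.naturality i.op) s)

lemma res_res (M : X.Modules) {U V W : X.Opens} (i : U ⟶ V) (j : V ⟶ W) (s : Γ(M, W)) :
    M.presheaf.map i.op (M.presheaf.map j.op s) = M.presheaf.map (i ≫ j).op s := by
  rw [op_comp, M.presheaf.map_comp]; rfl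

/-- Restriction to an open subset. -/
abbrev res {M : X.Modules} {U V : X.Opens} (h : U ≤ V) (s : Γ(M, V)) : Γ(M, U) :=
  M.presheaf.map (homOfLE h).op s

lemma app_resLE {M N : X.Modules} (α : M ⟶ N) {U V : X.Opens} (h : U ≤ V) (s : Γ(M, V)) :
    α.app U (res h s) = res h (α.app V s) :=
  app_res α _ s

lemma res_self {M : X.Modules} {U : X.Opens} (s : Γ(M, U)) : res le_rfl s = s := by
  have : (homOfLE (le_refl U)).op = 𝟙 _ := rfl
  rw [res, this, M.presheaf.map_id]; rfl

lemma res_trans {M : X.Modules} {U V W : X.Opens} (h : U ≤ V) (h' : V ≤ W) (s : Γ(M, W)) :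
    res h (res h' s) = res (h.trans h') s :=
  res_res M _ _ s

lemma res_injective (M : X.Modules) {U V : X.Opens} (h : U ≤ V) (e : V ≤ U) :
    Function.Injective (res (M := M) h) := fun s t hst ↦ by
  rw [← res_self s, ← res_self t, ← res_trans e h, ← res_trans e h, hst]

/-- The pullback of a section along a morphism of schemes. -/
def pull (f : Y ⟶ X) {M : X.Modules} {U : X.Opens} (s : Γ(M, U)) :
    Γ((Scheme.Modules.pullback f).obj M, f ⁻¹ᵁ U) :=
  ((Scheme.Modules.pullbackPushforwardAdjunction f).unit.app M).app U s

lemma pull_smul (f : Y ⟶ X) {M : X.Modules} {U : X.Opens} (a : Γ(X, U)) (s : Γ(M, U)) :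
    pull f (a • s) = f.app U a • pull f s :=
  Scheme.Modules.Hom.app_smul _ _ _

lemma pull_sum (f : Y ⟶ X) {M : X.Modules} {U : X.Opens} {ι : Type*} (t : Finset ι)
    (s : ι → Γ(M, U)) : pull f (∑ i ∈ t, s i) = ∑ i ∈ t, pull f (s i) := map_sum _ _ _

lemma pull_res (f : Y ⟶ X) {M : X.Modules} {U V : X.Opens} (h : U ≤ V) (s : Γ(M, V)) :
    pull f (res h s) = res (f.preimage_mono h) (pull f s) :=
  app_res _ _ _

lemma pull_app (f : Y ⟶ X) {M N : X.Modules} (α : M ⟶ N) {U : X.Opens} (s : Γ(M, U)) :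
    pull f (α.app U s) = ((Scheme.Modules.pullback f).map α).app (f ⁻¹ᵁ U) (pull f s) :=
  congr(($((Scheme.Modules.pullbackPushforwardAdjunction f).unit.naturality α)).app U s)

lemma homEquiv_app (f : Y ⟶ X) {M : X.Modules} {N : Y.Modules}
    (α : (Scheme.Modules.pullback f).obj M ⟶ N) {U : X.Opens} (s : Γ(M, U)) :
    ((Scheme.Modules.pullbackPushforwardAdjunction f).homEquiv M N α).app U s =
      α.app (f ⁻¹ᵁ U) (pull f s) := by
  rw [Adjunction.homEquiv_unit]; rfl

lemma homEquiv_symm_app_pull (f : Y ⟶ X) {M : X.Modules} {N : Y.Modules}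
    (α : M ⟶ (Scheme.Modules.pushforward f).obj N) {U : X.Opens} (s : Γ(M, U)) :
    (((Scheme.Modules.pullbackPushforwardAdjunction f).homEquiv M N).symm α).app (f ⁻¹ᵁ U)
      (pull f s) = α.app U s := by
  rw [← homEquiv_app, Equiv.apply_symm_apply]

lemma pullbackComp_hom_app_pull (f : Z ⟶ Y) (g : Y ⟶ X) {M : X.Modules} {U : X.Opens}
    (s : Γ(M, U)) :
    ((Scheme.Modules.pullbackComp f g).hom.app M).app ((f ≫ g) ⁻¹ᵁ U) (pull f (pull g s)) =
      pull (f ≫ g) s := by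
  have h := unit_conjugateEquiv
    ((Scheme.Modules.pullbackPushforwardAdjunction g).comp
      (Scheme.Modules.pullbackPushforwardAdjunction f))
    (Scheme.Modules.pullbackPushforwardAdjunction (f ≫ g))
    (Scheme.Modules.pullbackComp f g).inv M
  rw [Scheme.Modules.conjugateEquiv_pullbackComp_inv] at h
  have h' : pull f (pull g s) =
      ((Scheme.Modules.pullbackComp f g).inv.app M).app ((f ≫ g) ⁻¹ᵁ U) (pull (f ≫ g) s) :=
    congr(($h).app U s)
  rw [h']
  have := congr(($((Scheme.Modules.pullbackComp f g).inv_hom_id_app M)).app ((f ≫ g) ⁻¹ᵁ U)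
    (pull (f ≫ g) s))
  exact this

end Sections

section Generators

variable {X : Scheme.{u}}

/-- The sections `e i` over `U` generate `M` over every open subset of `U`. -/
def Generates {M : X.Modules} {U : X.Opens} {r : ℕ} (e : Fin r → Γ(M, U)) : Prop :=
  ∀ (V : X.Opens) (h : V ≤ U) (s : Γ(M, V)), ∃ f : Fin r → Γ(X, V), s = ∑ i, f i • res h (e i)

lemma Generates.res {M : X.Modules} {U V : X.Opens} {r : ℕ} {e : Fin r → Γ(M, U)}
    (he : Generates e) (h : V ≤ U) : Generates (fun i ↦ HiggsGr.res h (e i)) := fun W hW s ↦ by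
  obtain ⟨f, hf⟩ := he W (hW.trans h) s
  exact ⟨f, by simp only [res_trans]; exact hf⟩

lemma Generates.hom_ext {T : Scheme.{u}} {i : T ⟶ X} {M : X.Modules} {N : T.Modules}
    {α β : M ⟶ (Scheme.Modules.pushforward i).obj N} {U : X.Opens} {r : ℕ} {e : Fin r → Γ(M, U)}
    (he : Generates e) (hU : i ⁻¹ᵁ U = ⊤) (h : ∀ j, α.app U (e j) = β.app U (e j)) : α = β := by
  ext V s
  apply res_injective N (U := i ⁻¹ᵁ (V ⊓ U)) (V := i ⁻¹ᵁ V) (i.preimage_mono inf_le_left)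
  · rw [Scheme.Hom.preimage_inf, hU, inf_top_eq]
  obtain ⟨f, hf⟩ := he (V ⊓ U) inf_le_right (HiggsGr.res inf_le_left s)
  have key : α.app (V ⊓ U) (HiggsGr.res inf_le_left s) =
      β.app (V ⊓ U) (HiggsGr.res inf_le_left s) := by
    rw [hf, map_sum, map_sum]
    refine Finset.sum_congr rfl fun j _ ↦ ?_
    rw [Scheme.Modules.Hom.app_smul, Scheme.Modules.Hom.app_smul, app_res, app_res, h]
  rw [app_res, app_res] at key
  exact key

end Generators

section Free

variable {X : Scheme.{u}}

/-- The structure sheaf as a module over itself. -/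
abbrev unitModule (X : Scheme.{u}) : X.Modules := SheafOfModules.unit X.ringCatSheaf

/-- The free module of rank `r`. -/
abbrev freeModule (X : Scheme.{u}) (r : ℕ) : X.Modules :=
  SheafOfModules.free (R := X.ringCatSheaf) (ULift.{u} (Fin r))

/-- The inclusion of the `j`-th summand of a free module. -/
def ιFreeModule (X : Scheme.{u}) {r : ℕ} (j : Fin r) : unitModule X ⟶ freeModule X r :=
  SheafOfModules.ιFree (ULift.up j)

/-- The unit section of the structure sheaf. -/
def oneSec (U : X.Opens) : Γ(unitModule X, U) := (1 : Γ(X, U))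

lemma eq_smul_oneSec {U : X.Opens} (s : Γ(unitModule X, U)) :
    ∃ a : Γ(X, U), s = a • oneSec U :=
  ⟨s, (mul_one (M := Γ(X, U)) s).symm⟩

lemma oneSec_res {U V : X.Opens} (h : U ≤ V) : res h (oneSec V) = oneSec U :=
  map_one (X.presheaf.map (homOfLE h).op).hom

/-- The `j`-th basis section of a free module. -/
def freeSec {r : ℕ} (j : Fin r) (U : X.Opens) : Γ(freeModule X r, U) :=
  (ιFreeModule X j).app U (oneSec U)

lemma freeSec_res {r : ℕ} (j : Fin r) {U V : X.Opens} (h : U ≤ V) :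
    res h (freeSec j V) = freeSec j U := by
  rw [freeSec, freeSec, ← app_resLE, oneSec_res]

/-- The morphism from the structure sheaf given by a global section. -/
def unitDesc {M : X.Modules} (m : Γ(M, ⊤)) : unitModule X ⟶ M :=
  (SheafOfModules.unitHomEquiv (M : SheafOfModules X.ringCatSheaf)).symm
    (PresheafOfModules.sectionsMk (fun _ ↦ M.presheaf.map (homOfLE le_top).op m)
      (fun _ _ i ↦ res_res M i.unop (homOfLE le_top) m))

lemma unitDesc_app {M : X.Modules} (m : Γ(M, ⊤)) (U : X.Opens) :
    (unitDesc m).app U (oneSec U) = res le_top m := by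
  have := SheafOfModules.unitHomEquiv_apply_coe (M : SheafOfModules X.ringCatSheaf)
    (unitDesc m) (.op U)
  refine this.symm.trans ?_
  rw [unitDesc, Equiv.apply_symm_apply]
  rfl

/-- The morphism from a free module given by global sections. -/
def freeDesc {M : X.Modules} {r : ℕ} (m : Fin r → Γ(M, ⊤)) : freeModule X r ⟶ M :=
  Cofan.IsColimit.desc (SheafOfModules.isColimitFreeCofan _) (fun j ↦ unitDesc (m j.down))

lemma ιFreeModule_freeDesc {M : X.Modules} {r : ℕ} (m : Fin r → Γ(M, ⊤)) (j : Fin r) :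
    ιFreeModule X j ≫ freeDesc m = unitDesc (m j) :=
  Cofan.IsColimit.fac (SheafOfModules.isColimitFreeCofan (R := X.ringCatSheaf) _)
    (fun j : ULift.{u} (Fin r) ↦ unitDesc (m j.down)) (ULift.up j)

lemma freeDesc_app {M : X.Modules} {r : ℕ} (m : Fin r → Γ(M, ⊤)) (j : Fin r) (U : X.Opens) :
    (freeDesc m).app U (freeSec j U) = res le_top (m j) := by
  have := congr(($(ιFreeModule_freeDesc m j)).app U (oneSec U))
  rw [unitDesc_app] at this
  exact this

lemma freeModule_hom_ext {M : X.Modules} {r : ℕ} {α β : freeModule X r ⟶ M}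
    (h : ∀ j, ιFreeModule X j ≫ α = ιFreeModule X j ≫ β) : α = β :=
  Cofan.IsColimit.hom_ext (SheafOfModules.isColimitFreeCofan (R := X.ringCatSheaf) _) _ _
    (fun j ↦ h j.down)

lemma unitModule_hom_ext {M : X.Modules} {α β : unitModule X ⟶ M}
    (h : ∀ U, α.app U (oneSec U) = β.app U (oneSec U)) : α = β := by
  ext U s
  obtain ⟨a, rfl⟩ := eq_smul_oneSec s
  rw [Scheme.Modules.Hom.app_smul, Scheme.Modules.Hom.app_smul, h]

/-- The projection to the `j`-th summand of a free module. -/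
def πFreeModule (X : Scheme.{u}) {r : ℕ} (j : Fin r) : freeModule X r ⟶ unitModule X :=
  freeDesc (fun i ↦ if i = j then oneSec ⊤ else 0)

lemma ιFreeModule_πFreeModule_self {r : ℕ} (j : Fin r) :
    ιFreeModule X j ≫ πFreeModule X j = 𝟙 _ := by
  rw [πFreeModule, ιFreeModule_freeDesc, if_pos rfl]
  refine unitModule_hom_ext fun U ↦ ?_
  rw [unitDesc_app, oneSec_res]; rfl

lemma ιFreeModule_πFreeModule_of_ne {r : ℕ} {i j : Fin r} (h : i ≠ j) :
    ιFreeModule X i ≫ πFreeModule X j = 0 := by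
  rw [πFreeModule, ιFreeModule_freeDesc, if_neg h]
  refine unitModule_hom_ext fun U ↦ ?_
  rw [unitDesc_app, res, map_zero]; rfl

lemma sum_πFreeModule_ιFreeModule (r : ℕ) :
    ∑ j : Fin r, πFreeModule X j ≫ ιFreeModule X j = 𝟙 (freeModule X r) := by
  refine freeModule_hom_ext fun i ↦ ?_
  rw [Preadditive.comp_sum, Finset.sum_eq_single i]
  · rw [← Category.assoc, ιFreeModule_πFreeModule_self, Category.id_comp, Category.comp_id]
  · intro j _ hj
    rw [← Category.assoc, ιFreeModule_πFreeModule_of_ne hj.symm, zero_comp]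
  · simp

lemma sum_app {M N : X.Modules} {ι : Type*} (t : Finset ι) (α : ι → (M ⟶ N)) (U : X.Opens)
    (s : Γ(M, U)) : (∑ j ∈ t, α j).app U s = ∑ j ∈ t, (α j).app U s := by
  classical
  induction t using Finset.induction_on with
  | empty => rfl
  | insert a t ha ih => rw [Finset.sum_insert ha, Finset.sum_insert ha, ← ih]; rfl

lemma exists_eq_sum_freeSec {r : ℕ} {U : X.Opens} (s : Γ(freeModule X r, U)) :
    ∃ f : Fin r → Γ(X, U), s = ∑ j, f j • freeSec j U := by
  choose f hf using fun j ↦ eq_smul_oneSec ((πFreeModule X j).app U s)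
  refine ⟨f, ?_⟩
  have h := congr(($(sum_πFreeModule_ιFreeModule (X := X) r)).app U s)
  rw [sum_app] at h
  refine h.symm.trans (Finset.sum_congr rfl fun j _ ↦ ?_)
  rw [freeSec, ← Scheme.Modules.Hom.app_smul, ← hf j]; rfl

lemma isLocallyFreeOfRank_freeModule (X : Scheme.{u}) (r : ℕ) :
    IsLocallyFreeOfRank (freeModule X r) r := fun x ↦ by
  refine ⟨⊤, trivial, ⟨?_⟩⟩
  have := (Scheme.Modules.restrictAdjunction (⊤ : X.Opens).ι).leftAdjoint_preservesColimits.{u, u}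
  have : PreservesColimitsOfShape (Discrete (ULift.{u} (Fin r)))
    (Scheme.Modules.restrictFunctor (⊤ : X.Opens).ι) := inferInstance
  exact (@SheafOfModules.mapFreeIso _ _ _ _ _ _ _ _ _ _ _ _
    (Scheme.Modules.restrictFunctor (⊤ : X.Opens).ι)
    (ULift.{u} (Fin r)) this (Scheme.Modules.restrictUnitIso (⊤ : X.Opens).ι).symm).symm

end Free

section LocallyFree

variable {X : Scheme.{u}}

lemma res_sum {M : X.Modules} {U V : X.Opens} (h : U ≤ V) {ι : Type*} (t : Finset ι)
    (s : ι → Γ(M, V)) : res h (∑ i ∈ t, s i) = ∑ i ∈ t, res h (s i) := map_sum _ _ _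

lemma res_smul {M : X.Modules} {U V : X.Opens} (h : U ≤ V) (a : Γ(X, V)) (s : Γ(M, V)) :
    res h (a • s) = X.presheaf.map (homOfLE h).op a • res h s :=
  M.map_smul _ _ _

/-- A locally free module has, near each point, generating sections which can be mapped to
arbitrary global sections of a module supported there. -/
lemma IsLocallyFreeOfRank.exists_generates {M : X.Modules} {r : ℕ}
    (hM : IsLocallyFreeOfRank M r) (x : X) :
    ∃ U : X.Opens, x ∈ U ∧ ∃ e : Fin r → Γ(M, U), Generates e ∧
      ∀ (T : Scheme.{u}) (i : T ⟶ X) (_ : i ⁻¹ᵁ U = ⊤) (N : T.Modules) (n : Fin r → Γ(N, ⊤)),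
        ∃ α : M ⟶ (Scheme.Modules.pushforward i).obj N,
          ∀ j, α.app U (e j) = res (M := N) (U := i ⁻¹ᵁ U) le_top (n j) := by
  obtain ⟨U, hx, ⟨ε⟩⟩ := hM x
  let e (j : Fin r) : Γ(M, U.ι ''ᵁ ⊤) := ε.inv.app ⊤ (freeSec j ⊤)
  have he (V : (U : Scheme.{u}).Opens) (j : Fin r) :
      res (U.ι.image_mono le_top) (e j) = ε.inv.app V (freeSec j V) := by
    have h1 := app_resLE ε.inv (le_top : V ≤ ⊤) (freeSec j ⊤)
    rw [freeSec_res] at h1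
    exact h1.symm
  refine ⟨U.ι ''ᵁ ⊤, by simpa using hx, e, ?_, ?_⟩
  · intro V hV s
    obtain ⟨V, rfl⟩ : ∃ V' : (U : Scheme.{u}).Opens, V = U.ι ''ᵁ V' :=
      ⟨U.ι ⁻¹ᵁ V, by
        rw [Scheme.Hom.image_preimage_eq_opensRange_inf]
        exact (inf_eq_right.mpr (by simpa using hV)).symm⟩
    obtain ⟨f, hf⟩ := exists_eq_sum_freeSec (ε.hom.app V s)
    refine ⟨fun j ↦ (U.ι.appIso V).inv (f j), ?_⟩
    have h1 : ε.inv.app V (ε.hom.app V s) = s :=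
      congr(($(ε.hom_inv_id)).app V s)
    rw [← h1, hf, map_sum]
    refine Finset.sum_congr rfl fun j _ ↦ ?_
    rw [he]
    exact Scheme.Modules.Hom.app_smul ε.inv (f j) (freeSec j V)
  · intro T i hi N n
    obtain ⟨i, rfl⟩ : ∃ i' : T ⟶ U, i = i' ≫ U.ι :=
      ⟨IsOpenImmersion.lift U.ι i (by
        rintro _ ⟨t, rfl⟩
        have : t ∈ i ⁻¹ᵁ (U.ι ''ᵁ ⊤) := hi ▸ trivial
        simpa using this), (IsOpenImmersion.lift_fac _ _ _).symm⟩
    let n' (j : Fin r) : Γ((Scheme.Modules.pushforward i).obj N, ⊤) := n j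
    refine ⟨(Scheme.Modules.restrictAdjunction U.ι).unit.app M ≫
      (Scheme.Modules.pushforward U.ι).map (ε.hom ≫ freeDesc n') ≫
      (Scheme.Modules.pushforwardComp i U.ι).hom.app N, fun j ↦ ?_⟩
    have h2 := he (U.ι ⁻¹ᵁ (U.ι ''ᵁ ⊤)) j
    have h1 : ε.hom.app (U.ι ⁻¹ᵁ (U.ι ''ᵁ ⊤)) (ε.inv.app _ (freeSec j _)) = freeSec j _ :=
      congr(($(ε.inv_hom_id)).app _ (freeSec j _))
    rw [← h2] at h1
    have h3 := freeDesc_app n' j (U.ι ⁻¹ᵁ (U.ι ''ᵁ ⊤))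
    rw [← h1] at h3
    exact h3

end LocallyFree

section Sheafification

variable {X Y : Scheme.{u}}

lemma exists_sheafify_unit_eq (F : X.PresheafOfModules) {U : X.Opens}
    (s : Γ((sheafify X).obj F, U)) {x : X} (hx : x ∈ U) :
    ∃ (V : X.Opens) (h : V ≤ U) (t : F.obj (.op V)), x ∈ V ∧
      res h s = (((sheafifyAdj X).unit.app F).app (.op V)).hom t := by
  have h : TopCat.Presheaf.IsLocallySurjective
      (CategoryTheory.toSheafify (Opens.grothendieckTopology X) F.presheaf) := by
    unfold TopCat.Presheaf.IsLocallySurjective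
    infer_instance
  obtain ⟨V, ι, ⟨t, ht⟩, hV⟩ := (TopCat.Presheaf.isLocallySurjective_iff _).mp h U s x hx
  exact ⟨V, ι, t, hV, ht.symm⟩

lemma homEquiv_symm_sheafify_app (F : X.PresheafOfModules) (K : X.Modules)
    (α : F ⟶ (Scheme.Modules.toPresheafOfModules X).obj K) (U : X.Opens) (t : F.obj (.op U)) :
    (((sheafifyAdj X).homEquiv F K).symm α).app U
      ((((sheafifyAdj X).unit.app F).app (.op U)).hom t) = (α.app (.op U)).hom t := by
  have h := (sheafifyAdj X).homEquiv_unit (f := ((sheafifyAdj X).homEquiv F K).symm α)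
  rw [Equiv.apply_symm_apply] at h
  exact congr((($h).app (.op U)).hom t).symm

end Sheafification

section Tensor

variable {X Y : Scheme.{u}}

lemma tensorMap_tmul {M M' N N' : X.Modules} (f : M ⟶ M') (g : N ⟶ N') {U : X.Opens}
    (m : Γ(M, U)) (n : Γ(N, U)) :
    (tensorMap f g).app U (tmul m n) = tmul (f.app U m) (g.app U n) :=
  congr((($((sheafifyAdj X).unit.naturality
    (PresheafOfModules.Monoidal.tensorHom (R := X.presheaf) f.val g.val))).app (.op U)).hom
      (TensorProduct.tmul Γ(X, U) m n)).symm

lemma tensorLift_tmul {M N K : X.Modules} (β : ∀ U : X.Opens, Γ(M, U) → Γ(N, U) → Γ(K, U))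
    (h₁ h₂ h₃ h₄ h₅) {U : X.Opens} (m : Γ(M, U)) (n : Γ(N, U)) :
    (tensorLift β h₁ h₂ h₃ h₄ h₅).app U (tmul m n) = β U m n :=
  homEquiv_symm_sheafify_app (PresheafOfModules.Monoidal.tensorObj (R := X.presheaf) M.val N.val)
    K _ U (TensorProduct.tmul Γ(X, U) m n)

lemma tensorPush_tmul (f : Y ⟶ X) {M N : X.Modules} {M' N' : Y.Modules}
    (a : M ⟶ (Scheme.Modules.pushforward f).obj M')
    (b : N ⟶ (Scheme.Modules.pushforward f).obj N') {U : X.Opens} (m : Γ(M, U)) (n : Γ(N, U)) :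
    (tensorPush f a b).app U (tmul m n) = tmul (U := f ⁻¹ᵁ U) (a.app U m) (b.app U n) := by
  unfold tensorPush
  exact tensorLift_tmul _ _ _ _ _ _ m n

lemma tmul_resLE {M N : X.Modules} {U V : X.Opens} (h : U ≤ V) (m : Γ(M, V)) (n : Γ(N, V)) :
    tmul (res h m) (res h n) = res h (tmul m n) :=
  tmul_res (homOfLE h) m n

lemma sum_tmul {M N : X.Modules} {U : X.Opens} {ι : Type*} (t : Finset ι) (m : ι → Γ(M, U))
    (n : Γ(N, U)) : tmul (∑ i ∈ t, m i) n = ∑ i ∈ t, tmul (m i) n :=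
  (congrArg (tensorUnit M N U) (TensorProduct.sum_tmul t m n)).trans (map_sum _ _ _)

/-- The section `ω` over `U` generates the stalk of `N` at `x`. -/
def GeneratesAt {N : X.Modules} {U : X.Opens} (ω : Γ(N, U)) (x : X) : Prop :=
  ∀ (V : X.Opens) (h : V ≤ U), x ∈ V → ∀ s : Γ(N, V),
    ∃ (W : X.Opens) (h' : W ≤ V) (a : Γ(X, W)), x ∈ W ∧ res h' s = a • res (h'.trans h) ω

lemma GeneratesAt.res {N : X.Modules} {U V : X.Opens} {ω : Γ(N, U)} {x : X}
    (hω : GeneratesAt ω x) (h : V ≤ U) : GeneratesAt (HiggsGr.res h ω) x := fun W hW hx s ↦ by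
  obtain ⟨W', h', a, hx', ha⟩ := hω W (hW.trans h) hx s
  exact ⟨W', h', a, hx', by rw [ha, res_trans]⟩

lemma Generates.exists_eq_sum_tmul {M N : X.Modules} {U : X.Opens} {x : X} (hx : x ∈ U) {r : ℕ}
    {e : Fin r → Γ(M, U)} (he : Generates e) {ω : Γ(N, U)} (hω : GeneratesAt ω x)
    (s : Γ(tensor M N, U)) :
    ∃ (V : X.Opens) (h : V ≤ U) (a : Fin r → Γ(X, V)), x ∈ V ∧
      HiggsGr.res h s = ∑ j, a j • tmul (HiggsGr.res h (e j)) (HiggsGr.res h ω) := by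
  obtain ⟨V, hV, t, hxV, ht⟩ := exists_sheafify_unit_eq _ s hx
  suffices H : ∀ t : TensorProduct Γ(X, V) Γ(M, V) Γ(N, V),
      ∃ (W : X.Opens) (h : W ≤ V) (a : Fin r → Γ(X, W)), x ∈ W ∧
      HiggsGr.res h (tensorUnit M N V t) =
        ∑ j, a j • tmul (HiggsGr.res (h.trans hV) (e j)) (HiggsGr.res (h.trans hV) ω) by
    obtain ⟨W, h, a, hxW, ha⟩ := H t
    refine ⟨W, h.trans hV, a, hxW, ?_⟩
    rw [← ha, ← res_trans h hV]
    exact congrArg _ ht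
  intro t
  induction t using TensorProduct.induction_on with
  | zero => exact ⟨V, le_rfl, 0, hxV, by simp⟩
  | tmul m n =>
    obtain ⟨W, h, b, hxW, hb⟩ := hω V hV hxV n
    obtain ⟨f, hf⟩ := he W (h.trans hV) (HiggsGr.res h m)
    refine ⟨W, h, fun j ↦ b * f j, hxW, ?_⟩
    change HiggsGr.res h (tmul m n) = _
    rw [← tmul_resLE, hb, hf, tmul_smul, sum_tmul, Finset.smul_sum]
    refine Finset.sum_congr rfl fun j _ ↦ ?_
    rw [smul_tmul, mul_smul]
  | add t t' ih ih' =>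
    obtain ⟨W, h, a, hxW, ha⟩ := ih
    obtain ⟨W', h', a', hxW', ha'⟩ := ih'
    refine ⟨W ⊓ W', inf_le_left.trans h, fun j ↦
      X.presheaf.map (homOfLE inf_le_left).op (a j) +
        X.presheaf.map (homOfLE inf_le_right).op (a' j),
      ⟨hxW, hxW'⟩, ?_⟩
    have h1 := congrArg (HiggsGr.res (inf_le_left : W ⊓ W' ≤ W)) ha
    have h2 := congrArg (HiggsGr.res (inf_le_right : W ⊓ W' ≤ W')) ha'
    rw [res_trans, res_sum] at h1 h2
    rw [map_add, HiggsGr.res, map_add, ← HiggsGr.res]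
    refine (congrArg₂ (· + ·) h1 h2).trans ?_
    rw [← Finset.sum_add_distrib]
    refine Finset.sum_congr rfl fun j _ ↦ ?_
    rw [res_smul, res_smul, ← tmul_resLE, ← tmul_resLE]
    simp only [res_trans]
    rw [add_smul]

end Tensor

section Cotangent

variable {X : Scheme.{u}} {k : CommRingCat.{u}} (p : X ⟶ Spec k)

@[elab_as_elim]
lemma kaehlerDifferential_induction {A B : CommRingCat.{u}} {f : A ⟶ B}
    {motive : CommRingCat.KaehlerDifferential f → Prop} (zero : motive 0)
    (d : ∀ b : B, motive (CommRingCat.KaehlerDifferential.d b))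
    (add : ∀ s t, motive s → motive t → motive (s + t))
    (smul : ∀ (b : B) t, motive t → motive (b • t)) (t : CommRingCat.KaehlerDifferential f) :
    motive t := by
  let := f.hom.toAlgebra
  have ht : (show Ω[B⁄A] from t) ∈ Submodule.span B (Set.range (KaehlerDifferential.D A B)) :=
    (KaehlerDifferential.span_range_derivation A B).symm ▸ Submodule.mem_top
  refine Submodule.span_induction (p := fun s _ ↦ motive s) ?_ zero
    (fun s t _ _ ↦ add s t) (fun b t _ ↦ smul b t) ht
  rintro _ ⟨b, rfl⟩
  exact d b

lemma GeneratesAt.of_dSec {V : X.Opens} (hV : IsAffineOpen V) {x : X} (hx : x ∈ V)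
    {ω : Γ(cotangent p, V)} (hω : ∀ b : Γ(X, V), ∃ β : Γ(X, V), dSec p V b = β • ω) :
    GeneratesAt ω x := by
  intro W hW hxW s
  obtain ⟨W₁, hW₁, t, hxW₁, ht⟩ := exists_sheafify_unit_eq _ s hxW
  suffices H : ∀ t : CommRingCat.KaehlerDifferential ((constToPresheaf p).app (.op W₁)),
      ∃ (W' : X.Opens) (h : W' ≤ W₁) (a : Γ(X, W')), x ∈ W' ∧
      HiggsGr.res h (cotangentUnit p W₁ t) = a • HiggsGr.res (h.trans (hW₁.trans hW)) ω by
    obtain ⟨W', h, a, hxW', ha⟩ := H t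
    refine ⟨W', h.trans hW₁, a, hxW', ?_⟩
    rw [← ha, ← res_trans h hW₁]
    exact congrArg _ ht
  have hd (a : Γ(X, W₁)) : ∃ (W' : X.Opens) (h : W' ≤ W₁) (c : Γ(X, W')), x ∈ W' ∧
      HiggsGr.res h (dSec p W₁ a) = c • HiggsGr.res (h.trans (hW₁.trans hW)) ω := by
    obtain ⟨f, hf, hxf⟩ := hV.exists_basicOpen_le (V := W₁) ⟨x, hxW₁⟩ hx
    have hfV : X.basicOpen f ≤ V := X.basicOpen_le f
    let : Algebra Γ(X, V) Γ(X, X.basicOpen f) := (X.presheaf.map (homOfLE hfV).op).hom.toAlgebra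
    have : IsLocalization.Away f Γ(X, X.basicOpen f) := hV.isLocalization_basicOpen f
    let a' : Γ(X, X.basicOpen f) := X.presheaf.map (homOfLE hf).op a
    obtain ⟨n, b, hb⟩ := IsLocalization.Away.surj f a'
    obtain ⟨β, hβ⟩ := hω b
    obtain ⟨γ, hγ⟩ := hω (f ^ n)
    have hres (c δ : Γ(X, V)) (h : dSec p V c = δ • ω) :
        dSec p _ (algebraMap Γ(X, V) Γ(X, X.basicOpen f) c) =
          algebraMap Γ(X, V) Γ(X, X.basicOpen f) δ • HiggsGr.res hfV ω := by
      rw [RingHom.algebraMap_toAlgebra]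
      exact (dSec_res p (homOfLE hfV) c).trans ((congrArg _ h).trans (res_smul hfV δ ω))
    have hu : IsUnit (algebraMap Γ(X, V) Γ(X, X.basicOpen f) (f ^ n)) := by
      rw [map_pow]; exact (IsLocalization.Away.algebraMap_isUnit f).pow n
    obtain ⟨v, hv⟩ := hu.exists_left_inv
    refine ⟨X.basicOpen f, hf,
      v * (algebraMap _ _ β - a' * algebraMap _ _ γ), hxf, ?_⟩
    have h1 := hres _ _ hβ
    rw [← hb, ← map_pow, dSec_mul, hres _ _ hγ] at h1
    have h2 : HiggsGr.res hf (dSec p W₁ a) = dSec p _ a' := (dSec_res p (homOfLE hf) a).symm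
    rw [h2, mul_smul, sub_smul, mul_smul, ← h1, add_sub_cancel_left, ← mul_smul, hv, one_smul]
  intro t
  induction t using kaehlerDifferential_induction with
  | d a => exact hd a
  | zero => exact ⟨W₁, le_rfl, 0, hxW₁, by simp⟩
  | add t t' ih ih' =>
    obtain ⟨W', h, a, hxW', ha⟩ := ih
    obtain ⟨W'', h', a', hxW'', ha'⟩ := ih'
    refine ⟨W' ⊓ W'', inf_le_left.trans h,
      X.presheaf.map (homOfLE inf_le_left).op a + X.presheaf.map (homOfLE inf_le_right).op a',
      ⟨hxW', hxW''⟩, ?_⟩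
    have h1 := congrArg (HiggsGr.res (inf_le_left : W' ⊓ W'' ≤ W')) ha
    have h2 := congrArg (HiggsGr.res (inf_le_right : W' ⊓ W'' ≤ W'')) ha'
    rw [res_trans, res_smul, res_trans] at h1 h2
    rw [map_add, HiggsGr.res, map_add, add_smul]
    exact congrArg₂ (· + ·) h1 h2
  | smul c t ih =>
    obtain ⟨W', h, a, hxW', ha⟩ := ih
    refine ⟨W', h, X.presheaf.map (homOfLE h).op c * a, hxW', ?_⟩
    rw [map_smul, res_smul, ha, mul_smul]

lemma exists_generatesAt_cotangent (K : Type u) [Field K] (p : X ⟶ Spec (.of K))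
    [SmoothOfRelativeDimension 1 p] (x : X) :
    ∃ (V : X.Opens) (ω : Γ(cotangent p, V)), x ∈ V ∧ GeneratesAt ω x := by
  obtain ⟨U, hU, V, hV, hx, e, hf⟩ :=
    SmoothOfRelativeDimension.exists_isStandardSmoothOfRelativeDimension (n := 1) (f := p) x
  obtain rfl : U = ⊤ := by
    ext y
    simpa [Subsingleton.elim y (p x)] using e hx
  let : Algebra Γ(Spec (.of K), ⊤) Γ(X, V) := (p.appLE ⊤ V e).hom.toAlgebra
  have hS : Algebra.IsStandardSmoothOfRelativeDimension 1 Γ(Spec (.of K), ⊤) Γ(X, V) := hf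
  have : Nontrivial Γ(X, V) := by
    have : Nonempty V := ⟨⟨x, hx⟩⟩
    infer_instance
  have hrank := Algebra.IsStandardSmoothOfRelativeDimension.rank_kaehlerDifferential
    (R := Γ(Spec (.of K), ⊤)) (S := Γ(X, V)) 1
  have := Algebra.IsStandardSmoothOfRelativeDimension.isStandardSmooth
    (R := Γ(Spec (.of K), ⊤)) (S := Γ(X, V)) 1
  have : Module.Free Γ(X, V) (Ω[Γ(X, V)⁄Γ(Spec (.of K), ⊤)]) := inferInstance
  obtain ⟨w, hw⟩ : ∃ w : Ω[Γ(X, V)⁄Γ(Spec (.of K), ⊤)], ∀ v, ∃ c : Γ(X, V), c • w = v := by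
    obtain ⟨w, -, hw⟩ := rank_eq_one_iff.mp (by simpa using hrank)
    exact ⟨w, hw⟩
  let : Module Γ(Spec (.of K), ⊤) Γ(cotangent p, V) :=
    Module.compHom _ (algebraMap Γ(Spec (.of K), ⊤) Γ(X, V))
  have : IsScalarTower Γ(Spec (.of K), ⊤) Γ(X, V) Γ(cotangent p, V) :=
    IsScalarTower.of_algebraMap_smul fun _ _ ↦ rfl
  have hconst (c : Γ(Spec (.of K), ⊤)) : dSec p V (algebraMap _ _ c) = 0 := by
    have := dSec_const p (U := V) ((Scheme.ΓSpecIso (.of K)).hom c)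
    refine Eq.trans (congrArg _ ?_) this
    rw [RingHom.algebraMap_toAlgebra]
    simp [constToPresheaf, Scheme.Hom.appLE]
    rfl
  let D : Derivation Γ(Spec (.of K), ⊤) Γ(X, V) Γ(cotangent p, V) := Derivation.mk'
    { toFun := dSec p V
      map_add' := dSec_add p
      map_smul' := fun c a ↦ by
        rw [Algebra.smul_def, dSec_mul, hconst, smul_zero, add_zero]; rfl } (dSec_mul p)
  refine ⟨V, D.liftKaehlerDifferential w, hx, GeneratesAt.of_dSec p hV hx fun b ↦ ?_⟩
  obtain ⟨c, hc⟩ := hw (KaehlerDifferential.D _ _ b)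
  refine ⟨c, ?_⟩
  rw [← map_smul, hc, Derivation.liftKaehlerDifferential_comp_D]
  rfl

end Cotangent

section Fiber

variable {X Y T : Scheme.{u}} (i : T ⟶ X) {M N : X.Modules} {U V : X.Opens}

/-- The global section of the pullback given by a section over a neighbourhood of the image. -/
def ev (hU : ⊤ ≤ i ⁻¹ᵁ U) (s : Γ(M, U)) : Γ((Scheme.Modules.pullback i).obj M, ⊤) :=
  res hU (pull i s)

/-- The global function given by a function over a neighbourhood of the image. -/
def evFun (hU : ⊤ ≤ i ⁻¹ᵁ U) : Γ(X, U) →+* Γ(T, ⊤) :=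
  (i.app U ≫ T.presheaf.map (homOfLE hU).op).hom

lemma ev_sum (hU : ⊤ ≤ i ⁻¹ᵁ U) {ι : Type*} (t : Finset ι) (s : ι → Γ(M, U)) :
    ev i hU (∑ j ∈ t, s j) = ∑ j ∈ t, ev i hU (s j) := by
  rw [ev, pull_sum, res_sum]; rfl

lemma ev_smul (hU : ⊤ ≤ i ⁻¹ᵁ U) (a : Γ(X, U)) (s : Γ(M, U)) :
    ev i hU (a • s) = evFun i hU a • ev i hU s := by
  rw [ev, pull_smul, res_smul]; rfl

lemma ev_res (h : U ≤ V) (hU : ⊤ ≤ i ⁻¹ᵁ U) (s : Γ(M, V)) :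
    ev i hU (res h s) = ev i (hU.trans (i.preimage_mono h)) s := by
  rw [ev, pull_res, res_trans]; rfl

lemma ev_app (hU : ⊤ ≤ i ⁻¹ᵁ U) (α : M ⟶ N) (s : Γ(M, U)) :
    ev i hU (α.app U s) = ((Scheme.Modules.pullback i).map α).app ⊤ (ev i hU s) := by
  rw [ev, pull_app, ← app_resLE]; rfl

lemma pullbackComp_hom_app_ev (g : T ⟶ Y) (π : Y ⟶ X) (hU : ⊤ ≤ (g ≫ π) ⁻¹ᵁ U)
    (hU' : ⊤ ≤ g ⁻¹ᵁ π ⁻¹ᵁ U) (s : Γ(M, U)) :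
    ((Scheme.Modules.pullbackComp g π).hom.app M).app ⊤ (ev g hU' (pull π s)) =
      ev (g ≫ π) hU s := by
  have h := app_resLE ((Scheme.Modules.pullbackComp g π).hom.app M) hU (pull g (pull π s))
  rw [pullbackComp_hom_app_pull] at h
  exact h

variable {i}

lemma Generates.pullback_hom_ext {N : T.Modules} {r : ℕ} {e : Fin r → Γ(M, U)}
    (he : Generates e) (hU : ⊤ ≤ i ⁻¹ᵁ U) {α β : (Scheme.Modules.pullback i).obj M ⟶ N}
    (h : ∀ j, α.app ⊤ (ev i hU (e j)) = β.app ⊤ (ev i hU (e j))) : α = β := by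
  apply ((Scheme.Modules.pullbackPushforwardAdjunction i).homEquiv M N).injective
  refine he.hom_ext (top_le_iff.mp hU) fun j ↦ ?_
  rw [homEquiv_app, homEquiv_app]
  apply res_injective N hU le_top
  rw [← app_resLE, ← app_resLE]
  exact h j

lemma oneSec_injective {a b : Γ(T, ⊤)} (h : a • oneSec (X := T) ⊤ = b • oneSec ⊤) : a = b := by
  have h1 (c : Γ(T, ⊤)) : c • oneSec (X := T) ⊤ = c := mul_one (M := Γ(T, ⊤)) c
  rwa [h1, h1] at h

lemma freeSec_injective {r : ℕ} (j : Fin r) {a b : Γ(T, ⊤)}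
    (h : a • freeSec (X := T) j ⊤ = b • freeSec j ⊤) : a = b := by
  have h1 : (πFreeModule T j).app ⊤ (freeSec j ⊤) = oneSec ⊤ :=
    congr(($(ιFreeModule_πFreeModule_self (X := T) j)).app ⊤ (oneSec ⊤))
  have h2 := congrArg ((πFreeModule T j).app ⊤) h
  rw [Scheme.Modules.Hom.app_smul, Scheme.Modules.Hom.app_smul, h1] at h2
  exact oneSec_injective h2

lemma epi_of_isUnit_smul_freeSec {E : T.Modules} (r : E ⟶ freeModule T 1) (s : Γ(E, ⊤))
    {a : Γ(T, ⊤)} (ha : IsUnit a) (h : r.app ⊤ s = a • freeSec 0 ⊤) : Epi r := by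
  refine ⟨fun {N} α β hαβ ↦ ?_⟩
  have h1 : α.app ⊤ (freeSec 0 ⊤) = β.app ⊤ (freeSec 0 ⊤) := by
    have h2 : α.app ⊤ (r.app ⊤ s) = β.app ⊤ (r.app ⊤ s) := congr(($hαβ).app ⊤ s)
    rw [h, Scheme.Modules.Hom.app_smul, Scheme.Modules.Hom.app_smul] at h2
    exact ha.smul_left_cancel.mp h2
  refine freeModule_hom_ext fun j ↦ unitModule_hom_ext fun W ↦ ?_
  obtain rfl := Subsingleton.elim j 0
  change α.app W (freeSec 0 W) = β.app W (freeSec 0 W)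
  rw [← freeSec_res 0 (le_top : W ≤ ⊤), app_resLE, app_resLE, h1]

end Fiber

section Higgs

variable {X Y : Scheme.{u}} {k : CommRingCat.{u}} (p : X ⟶ Spec k)

lemma comp_app_apply {M N L : X.Modules} (α : M ⟶ N) (β : N ⟶ L) {U : X.Opens} (s : Γ(M, U)) :
    (α ≫ β).app U s = β.app U (α.app U s) := rfl

lemma app_smul_pushforward (f : Y ⟶ X) {M : X.Modules} {N : Y.Modules}
    (α : M ⟶ (Scheme.Modules.pushforward f).obj N) {U : X.Opens} (a : Γ(X, U)) (s : Γ(M, U)) :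
    α.app U (a • s) = (f.app U a • (show Γ(N, f ⁻¹ᵁ U) from α.app U s) : Γ(N, f ⁻¹ᵁ U)) :=
  Scheme.Modules.Hom.app_smul α a s

lemma pullbackHiggsField_app_pull (f : Y ⟶ X) {E : X.Modules}
    (φ : E ⟶ tensor E (cotangent p)) {U : X.Opens} (s : Γ(E, U)) {r : ℕ}
    (a : Fin r → Γ(X, U)) (e : Fin r → Γ(E, U)) (ω : Γ(cotangent p, U))
    (h : φ.app U s = ∑ j, a j • tmul (e j) ω) :
    (pullbackHiggsField f p φ).app (f ⁻¹ᵁ U) (pull f s) =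
      ∑ j, f.app U (a j) • tmul (U := f ⁻¹ᵁ U) (pull f (e j)) ((cotangentMap f p).app U ω) := by
  refine (homEquiv_symm_app_pull f (φ ≫ tensorPush f _ _) s).trans ?_
  rw [comp_app_apply, h, map_sum]
  refine Finset.sum_congr rfl fun j _ ↦ ?_
  rw [app_smul_pushforward, tensorPush_tmul]
  rfl

/-- Near each point, a Higgs field on a curve is given by a matrix of functions. -/
lemma HiggsBundleOnCurve.exists_matrix {r : ℕ} {K : Type u} [Field K] (p : X ⟶ Spec (.of K))
    [SmoothOfRelativeDimension 1 p] (F : HiggsBundleOnCurve p r) (x : X) :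
    ∃ (U : X.Opens) (e : Fin r → Γ(F.E, U)) (ω : Γ(cotangent p, U))
      (a : Fin r → Fin r → Γ(X, U)), x ∈ U ∧ Generates e ∧
      (∀ j, F.φ.app U (e j) = ∑ l, a j l • tmul (e l) ω) ∧
      ∀ (T : Scheme.{u}) (i : T ⟶ X) (hU : ⊤ ≤ i ⁻¹ᵁ U) (N : T.Modules) (n : Fin r → Γ(N, ⊤)),
        ∃ α : (Scheme.Modules.pullback i).obj F.E ⟶ N, ∀ j, α.app ⊤ (ev i hU (e j)) = n j := by
  obtain ⟨U, hxU, e, he, hfree⟩ := F.locallyFree.exists_generates x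
  obtain ⟨V, ω, hxV, hω⟩ := exists_generatesAt_cotangent K p x
  have he' := he.res (inf_le_left : U ⊓ V ≤ U)
  have hω' := hω.res (inf_le_right : U ⊓ V ≤ V)
  choose W hW a hxW ha using fun j ↦ he'.exists_eq_sum_tmul (show x ∈ U ⊓ V from ⟨hxU, hxV⟩) hω'
    (F.φ.app (U ⊓ V) (res inf_le_left (e j)))
  let W₀ : X.Opens := (U ⊓ V) ⊓ Finset.univ.inf W
  have h₀ (j) : W₀ ≤ W j := inf_le_right.trans (Finset.inf_le (Finset.mem_univ j))
  have hU : W₀ ≤ U := inf_le_left.trans inf_le_left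
  have hV : W₀ ≤ V := inf_le_left.trans inf_le_right
  refine ⟨W₀, fun j ↦ res hU (e j), res hV ω,
    fun j l ↦ X.presheaf.map (homOfLE (h₀ j)).op (a j l), ⟨⟨hxU, hxV⟩, ?_⟩, he.res hU, ?_, ?_⟩
  · rw [TopologicalSpace.Opens.coe_finset_inf]
    simpa using hxW
  · intro j
    have h1 := congrArg (res (h₀ j)) (ha j)
    rw [res_sum, res_trans, ← app_resLE, res_trans] at h1
    rw [h1]
    refine Finset.sum_congr rfl fun l _ ↦ ?_
    rw [res_smul, ← tmul_resLE]
    simp only [res_trans]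
  · intro T i hi N n
    have hi' : ⊤ ≤ i ⁻¹ᵁ U := hi.trans (i.preimage_mono hU)
    obtain ⟨α, hα⟩ := hfree T i (top_le_iff.mp hi') N n
    refine ⟨((Scheme.Modules.pullbackPushforwardAdjunction i).homEquiv _ _).symm α, fun j ↦ ?_⟩
    rw [ev_res, ev, app_resLE, homEquiv_symm_app_pull, hα]
    exact (res_trans hi' le_top (n j)).trans (res_self _)

end Higgs

section Main

variable {X : Scheme.{u}}

lemma exists_eigenvector_of_ringEquiv {K : Type*} [Field K] [IsAlgClosed K] {B : Type*} [CommRing B]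
    (σ : K ≃+* B) {r : ℕ} [NeZero r] (A : Fin r → Fin r → B) :
    ∃ (c : B) (v : Fin r → B), (∃ j, IsUnit (v j)) ∧ ∀ j, ∑ l, A j l * v l = c * v j := by
  obtain ⟨μ, hμ⟩ := Module.End.exists_eigenvalue
    (Matrix.toLin' (Matrix.of fun j l ↦ σ.symm (A j l)))
  obtain ⟨v, hv⟩ := hμ.exists_hasEigenvector
  obtain ⟨j, hj⟩ := Function.ne_iff.mp hv.2
  refine ⟨σ μ, fun l ↦ σ (v l), ⟨j, (IsUnit.mk0 _ hj).map σ⟩, fun l ↦ ?_⟩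
  have h := congrArg σ (congrFun hv.apply_eq_smul l)
  simpa [Matrix.mulVec, dotProduct] using h

/-- The Higgs composition vanishes at a point of the Grassmann bundle whose quotient is given by an
eigenvector of the matrix of the Higgs field. -/
lemma pullback_map_higgsComposition_eq_zero {k : CommRingCat.{u}} (p : X ⟶ Spec k) {r : ℕ}
    (F : HiggsBundleOnCurve p r) (G : GrassmannBundle F.E 1) {T : Scheme.{u}} (g : T ⟶ G.P)
    (t : T) (ht : ∀ W : T.Opens, t ∈ W → ⊤ ≤ W) {U : X.Opens} (hU : ⊤ ≤ (g ≫ G.π) ⁻¹ᵁ U)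
    (hU' : ⊤ ≤ g ⁻¹ᵁ G.π ⁻¹ᵁ U)
    {e : Fin r → Γ(F.E, U)} (he : Generates e) {ω : Γ(cotangent p, U)}
    {a : Fin r → Fin r → Γ(X, U)} (ha : ∀ j, F.φ.app U (e j) = ∑ l, a j l • tmul (e l) ω)
    (ε : (Scheme.Modules.pullback g).obj G.Q ≅ freeModule T 1)
    (c : Γ(T, ⊤)) (v : Fin r → Γ(T, ⊤)) (hv : ∃ j, IsUnit (v j))
    (hc : ∀ j, ∑ l, evFun (g ≫ G.π) hU (a j l) * v l = c * v j)
    (hε : ∀ j, ε.hom.app ⊤ (((Scheme.Modules.pullback g).map G.q).app ⊤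
      (ev g hU' (pull G.π (e j)))) = v j • freeSec 0 ⊤) :
    (Scheme.Modules.pullback g).map (higgsComposition p F G) = 0 := by
  obtain ⟨W, hyW, η, hη, -⟩ := G.locallyFree_Q.exists_generates (g t)
  have hW : ⊤ ≤ g ⁻¹ᵁ (W ⊓ G.π ⁻¹ᵁ U) := ht _ ⟨hyW, hU' trivial⟩
  let ω' : Γ(cotangent (G.π ≫ p), G.π ⁻¹ᵁ U) := (cotangentMap G.π p).app U ω
  choose b hb using fun l ↦ hη _ inf_le_left
    (res (inf_le_right : W ⊓ G.π ⁻¹ᵁ U ≤ _) (G.q.app _ (pull G.π (e l))))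
  simp only [Fin.sum_univ_one] at hb
  let η' : Γ(G.Q, W ⊓ G.π ⁻¹ᵁ U) := res inf_le_left (η 0)
  let τ := ev g hW (tmul η' (res inf_le_right ω'))
  let β (l : Fin r) : Γ(T, ⊤) := evFun g hW (b l 0)
  have hq (l) : ev g hU' (G.q.app _ (pull G.π (e l))) = β l • ev g hW η' := by
    rw [← ev_smul, ← hb l, ev_res]
  have hqω (l) : ev g hU' (tmul (G.q.app _ (pull G.π (e l))) ω') = β l • τ := by
    rw [← ev_smul, ← smul_tmul, ← hb l, tmul_resLE, ev_res]
  obtain ⟨θ, hθ⟩ := exists_eq_sum_freeSec (ε.hom.app ⊤ (ev g hW η'))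
  rw [Fin.sum_univ_one] at hθ
  have hβ (l) : β l * θ 0 = v l := by
    refine freeSec_injective (T := T) (0 : Fin 1) ?_
    rw [← hε, ← ev_app g hU', hq, Scheme.Modules.Hom.app_smul, hθ, mul_smul]
  have hθu : IsUnit (θ 0) := by
    obtain ⟨j, hj⟩ := hv
    rw [← hβ] at hj
    exact isUnit_of_mul_isUnit_right hj
  obtain ⟨θ', hθ'⟩ := hθu.exists_right_inv
  have hcβ (j) : ∑ l, evFun (g ≫ G.π) hU (a j l) * β l = c * β j := by
    refine hθu.mul_left_injective ?_
    simp only [Finset.sum_mul, mul_assoc, hβ, hc]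
  let γ : (Scheme.Modules.pullback g).obj G.Q ⟶
      (Scheme.Modules.pullback g).obj (tensor G.Q (cotangent (G.π ≫ p))) :=
    ε.hom ≫ freeDesc (fun _ ↦ (θ' * c) • τ)
  have hγ : γ.app ⊤ (ev g hW η') = c • τ := by
    rw [comp_app_apply, hθ, Scheme.Modules.Hom.app_smul, freeDesc_app, res_self, ← mul_smul,
      ← mul_assoc, hθ', one_mul]
  have key : (Scheme.Modules.pullback g).map
      (pullbackHiggsField G.π p F.φ ≫ tensorMap G.q (𝟙 _)) =
        (Scheme.Modules.pullback g).map G.q ≫ γ := by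
    rw [← cancel_epi ((Scheme.Modules.pullbackComp g G.π).inv.app F.E)]
    refine he.pullback_hom_ext hU fun j ↦ ?_
    have hinv : ((Scheme.Modules.pullbackComp g G.π).inv.app F.E).app ⊤ (ev (g ≫ G.π) hU (e j)) =
        ev g hU' (pull G.π (e j)) := by
      rw [← pullbackComp_hom_app_ev g G.π hU hU']
      exact congr(($((Scheme.Modules.pullbackComp g G.π).hom_inv_id_app F.E)).app ⊤ _)
    rw [comp_app_apply, comp_app_apply, hinv, ← ev_app g hU', comp_app_apply,
      comp_app_apply, ← ev_app g hU', hq,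
      Scheme.Modules.Hom.app_smul, hγ,
      pullbackHiggsField_app_pull p G.π F.φ (e j) (a j) e ω (ha j), map_sum, ev_sum,
      ← mul_smul, mul_comm, ← hcβ, Finset.sum_smul]
    refine Finset.sum_congr rfl fun l _ ↦ ?_
    rw [Scheme.Modules.Hom.app_smul, ev_smul, mul_smul, ← hqω]
    exact congrArg (fun s ↦ evFun g hU' (G.π.app U (a j l)) • ev g hU' s)
      (tensorMap_tmul G.q (𝟙 _) (pull G.π (e l)) ω')
  rw [higgsComposition, Functor.map_comp, key, ← Category.assoc, ← Functor.map_comp,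
    kernel.condition, Functor.map_zero, zero_comp]

lemma nonempty_subscheme_zeroLocusIdeal {Y T : Scheme.{u}} [Nonempty T] (g : T ⟶ Y)
    [IsClosedImmersion g] {M N : Y.Modules} (u : M ⟶ N)
    (hu : (Scheme.Modules.pullback g).map u = 0) : Nonempty (zeroLocusIdeal u).subscheme := by
  have h : (Scheme.Modules.pullback g.ker.subschemeι).map u = 0 := by
    have e : inv g.toImage ≫ g = g.ker.subschemeι := by
      rw [IsIso.inv_comp_eq]; exact g.toImage_imageι.symm
    rw [← e]
    have h := (Scheme.Modules.pullbackComp (inv g.toImage) g).inv.naturality u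
    rw [Functor.comp_map, hu, Functor.map_zero, comp_zero] at h
    rwa [← cancel_mono ((Scheme.Modules.pullbackComp (inv g.toImage) g).inv.app N), zero_comp]
  have hle : zeroLocusIdeal u ≤ g.ker := sInf_le h
  exact ⟨Scheme.IdealSheafData.inclusion hle (g.toImage (Classical.arbitrary T))⟩

theorem nonempty_higgsGrassmannian {K : Type u} [Field K] [IsAlgClosed K]
    (p : X ⟶ Spec (.of K)) [SmoothOfRelativeDimension 1 p] [Nonempty X] {r : ℕ} [NeZero r]
    (F : HiggsBundleOnCurve p r) (G : GrassmannBundle F.E 1) :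
    Nonempty (higgsGrassmannian p F G) := by
  have := SmoothOfRelativeDimension.smooth 1 p
  have : JacobsonSpace X := LocallyOfFiniteType.jacobsonSpace p
  obtain ⟨x, -, hx⟩ : ((Set.univ : Set X) ∩ closedPoints X).Nonempty :=
    nonempty_inter_closedPoints Set.univ_nonempty isOpen_univ.isLocallyClosed
  obtain ⟨U, e, ω, a, hxU, he, ha, hfree⟩ := F.exists_matrix p x
  obtain ⟨i, hi, hix⟩ : ∃ i : Spec (.of K) ⟶ X, i ≫ p = 𝟙 _ ∧ ∀ t, i t = x :=
    ⟨pointOfClosedPoint p x hx, pointOfClosedPoint_comp p x hx, pointOfClosedPoint_apply p x hx⟩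
  have hU : ⊤ ≤ i ⁻¹ᵁ U := fun t _ ↦ by
    change i t ∈ U
    rwa [hix]
  obtain ⟨c, v, hv, hc⟩ := exists_eigenvector_of_ringEquiv
    (Scheme.ΓSpecIso (.of K)).symm.commRingCatIsoToRingEquiv (fun j l ↦ evFun i hU (a j l))
  obtain ⟨ρ, hρ⟩ := hfree _ i hU (freeModule _ 1) (fun j ↦ v j • freeSec 0 ⊤)
  have hepi : Epi ρ := by
    obtain ⟨j, hj⟩ := hv
    exact epi_of_isUnit_smul_freeSec ρ _ hj (hρ j)
  obtain ⟨g, ⟨rfl, ε, hε⟩, -⟩ :=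
    G.existsUnique_hom _ i _ ρ hepi (isLocallyFreeOfRank_freeModule _ 1)
  have : IsClosedImmersion g := isClosedImmersion_of_comp_eq_id (G.π ≫ p) g (by simpa using hi)
  have hU' : ⊤ ≤ g ⁻¹ᵁ G.π ⁻¹ᵁ U := hU
  let t : Spec (.of K) := IsLocalRing.closedPoint K
  have : Nonempty (Spec (.of K)) := ⟨t⟩
  refine nonempty_subscheme_zeroLocusIdeal g _ (pullback_map_higgsComposition_eq_zero p F G g t
    (fun W ht s _ ↦ Subsingleton.elim t s ▸ ht) hU hU' he ha ε c v hv hc fun j ↦ ?_)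
  rw [← comp_app_apply, hε, ← hρ, comp_app_apply, pullbackComp_hom_app_ev g G.π hU hU']
  rfl

end Main

end HiggsGr

end

theorem mainTheorem4 (X : Scheme.{0}) (p : X ⟶ Spec (CommRingCat.of ℂ))
    [SmoothOfRelativeDimension 1 p] [IsSeparated p] [QuasiCompact p] [ConnectedSpace X]
    (F : HiggsGr.HiggsBundleOnCurve p 2) (G : HiggsGr.GrassmannBundle F.E 1) :
    Nonempty (HiggsGr.higgsGrassmannian p F G) := by
  exact HiggsGr.nonempty_higgsGrassmannian p F G
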